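/- Let $\mathcal{F}$ be the set of cumulative distribution functions (cdfs) on $\mathbb{R}$, i.e. of non-decreasing right-continuous maps $F:\mathbb{R}\to\mathbb{R}$ with $\lim_{x\to-\infty}F(x)=0$ and $\lim_{x\to\infty}F(x)=1$, and let $\mathcal{F}_c\subset\mathcal{F}$ be the set of continuous cdfs. For $F,G\in\mathcal{F}$ write $D_u(F,G)=\sup_{x}|F(x)-G(x)|$ and $(F\star G)(x)=\int F(x-y)\,dG(y)$; if $G\in\mathcal{F}_c$, then $F\star G\in\mathcal{F}_c$. The weak topology on $\mathcal{F}$ is the initial topology for the maps $F\mapsto\int h\,dF$, $h:\mathbb{R}\to\mathbb{R}$ bounded and continuous. An approach system on a set $X$ assigns to each $x\in X$ an ideal $\mathcal{A}_x$ of functions $X\to[0,\infty]$ (containing $0$, closed under finite suprema and under passing to smaller functions) such that: $\phi(x)=0$ for all $\phi\in\mathcal{A}_x$; if for all $\epsilon>0$ and $\omega<\infty$ there is $\psi\in\mathcal{A}_x$ with $\min(\phi,\omega)\le\psi+\epsilon$, then $\phi\in\mathcal{A}_x$; and for all $\phi\in\mathcal{A}_x$, $\epsilon>0$, $\omega<\infty$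 there are $\phi_z\in\mathcal{A}_z$ $(z\in X)$ with $\min(\phi(y),\omega)\le\phi_x(z)+\phi_z(y)+\epsilon$ for all $y,z\in X$. A map $f$ from a space with approach system $\mathcal{A}$ to one with approach system $\mathcal{A}'$ is a contraction if $\psi\circ f\in\mathcal{A}_x$ for all $x$ and all $\psi\in\mathcal{A}'_{f(x)}$. A metric $d$ induces the approach system $\mathcal{A}_x=\{\phi\mid\phi\le d(x,\cdot)\}$. The continuity approach structure $\mathcal{A}_c$ on $\mathcal{F}$ is the initial approach structure for the maps $\mathcal{F}\to(\mathcal{F}_c,D_u):F\mapsto F\star G$, $G\in\mathcal{F}_c$, i.e. the smallest approach system (pointwise with respect to inclusion) for which all these maps are contractions. A sequence $(F_n)_n$ in $\mathcal{F}$ is $\epsilon$-convergent to $F\in\mathcal{F}$ if for each $\phi\in(\mathcal{A}_c)_F$ one has $\phi(F_n)<\epsilon$ for all sufficiently large $n$. For $\mathcal{D}\subset\mathcal{F}$ let $\chi_{rsc}(\mathcal{D})$ be the infimum of the real numbers $\alpha>0$ for which each sequence in $\mathcal{D}$ has a subsequence that is $\alpha$-convergent to some point of $\mathcal{F}$, and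 let $\chi_{rc}(\mathcal{D})$ be the infimum of the real numbers $\alpha>0$ such that for each choice of functions $\phi_F\in(\mathcal{A}_c)_F$ $(F\in\mathcal{F})$ there is a finite set $\mathcal{E}\subset\mathcal{F}$ with $\mathcal{D}\subset\bigcup_{F\in\mathcal{E}}\{G\in\mathcal{F}\mid\phi_F(G)<\alpha\}$. **Theorem.** For every set $\mathcal{D}\subset\mathcal{F}$ we have $\chi_{rsc}(\mathcal{D})=\chi_{rc}(\mathcal{D})$. Furthermore, each sequence in $\mathcal{D}$ has a subsequence that converges in the weak topology to an element of $\mathcal{F}$ if and only if $\chi_{rsc}(\mathcal{D})=0$. -/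

import Mathlib

open MeasureTheory Filter Topology Set
open scoped ENNReal BoundedContinuousFunction

/-- An approach space structure on `X`, presented by its approach system: to every point `x`
is assigned a saturated ideal `sys x` of functions `X → [0, ∞]` such that every member of
`sys x` vanishes at `x` and the mixed triangle inequality holds. -/
@[ext]
structure ApproachSystem (X : Type*) where
  /-- the ideal of local distances at a point -/
  sys : X → Set (X → ℝ≥0∞)
  zero_mem : ∀ x, (fun _ => 0) ∈ sys x
  sup_mem : ∀ x, ∀ φ ∈ sys x, ∀ ψ ∈ sys x, φ ⊔ ψ ∈ sys x
  lower : ∀ x, ∀ φ ∈ sys x, ∀ ψ : X → ℝ≥0∞, ψ ≤ φ → ψ ∈ sys x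
  apply_self : ∀ x, ∀ φ ∈ sys x, φ x = 0
  saturated : ∀ x, ∀ φ : X → ℝ≥0∞,
    (∀ ε : ℝ≥0∞, 0 < ε → ∀ ω : ℝ≥0∞, ω ≠ ⊤ →
      ∃ ψ ∈ sys x, ∀ y, min (φ y) ω ≤ ψ y + ε) → φ ∈ sys x
  triangle : ∀ x, ∀ φ ∈ sys x, ∀ ε : ℝ≥0∞, 0 < ε → ∀ ω : ℝ≥0∞, ω ≠ ⊤ →
    ∃ Ψ : X → X → ℝ≥0∞, (∀ z, Ψ z ∈ sys z) ∧
      ∀ y z, min (φ y) ω ≤ Ψ x z + Ψ z y + ε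

namespace ApproachSystem

/-- A map between approach spaces is a contraction iff pulling back local distances at `f x`
yields local distances at `x`. -/
def IsContraction {X Y : Type*} (A : ApproachSystem X) (B : ApproachSystem Y) (f : X → Y) :
    Prop :=
  ∀ x, ∀ ψ ∈ B.sys (f x), ψ ∘ f ∈ A.sys x

/-- The approach structure underlying a (quasi-)metric `d`: the local distances at `x` are the
functions dominated by `d x`. -/
def ofMetric {X : Type*} (d : X → X → ℝ≥0∞) (hself : ∀ x, d x x = 0)
    (htri : ∀ x y z, d x z ≤ d x y + d y z) : ApproachSystem X where
  sys x := {φ | φ ≤ d x}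
  zero_mem _ _ := zero_le
  sup_mem x φ hφ ψ hψ := sup_le (α := X → ℝ≥0∞) (c := d x) hφ hψ
  lower _ _ hφ _ h := h.trans hφ
  apply_self x _ hφ := le_antisymm ((hφ x).trans (hself x).le) zero_le
  saturated x φ h y := by
    refine ENNReal.le_of_forall_pos_le_add fun ε hε hfin => ?_
    obtain ⟨ψ, hψ, hle⟩ := h (min (ε : ℝ≥0∞) 1) (by simpa using hε)
      (d x y + 2) (by simpa using hfin.ne)
    have h1 := (hle y).trans (add_le_add_left (hψ y) _)
    have h2 : d x y + min (ε : ℝ≥0∞) 1 < d x y + 2 := by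
      refine (ENNReal.add_lt_add_iff_left hfin.ne).2 ((min_le_right _ _).trans_lt ?_)
      exact ENNReal.one_lt_two
    rcases min_le_iff.1 h1 with h3 | h3
    · exact h3.trans (add_le_add_right (min_le_left _ _) _)
    · exact absurd h3 (not_le.2 h2)
  triangle x φ hφ ε _ ω _ := ⟨d, fun z => le_refl (d z), fun y z =>
    (min_le_left _ _).trans ((hφ y).trans ((htri x z y).trans le_self_add))⟩

/-- The initial approach structure for a source `(f i : X → Y i)`: the local distances at `x`
are generated, under saturation, by the finite suprema of the functions `ψ ∘ f i` with `ψ` a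
local distance at `f i x`. -/
def initial {ι X : Type*} {Y : ι → Type*} (B : ∀ i, ApproachSystem (Y i)) (f : ∀ i, X → Y i) :
    ApproachSystem X where
  sys x := {φ | ∀ ε : ℝ≥0∞, 0 < ε → ∀ ω : ℝ≥0∞, ω ≠ ⊤ →
    ∃ (K : Finset ι) (ψ : ∀ i, Y i → ℝ≥0∞), (∀ i, ψ i ∈ (B i).sys (f i x)) ∧
      ∀ y, min (φ y) ω ≤ (K.sup fun i => ψ i (f i y)) + ε}
  zero_mem x ε _ ω _ := ⟨∅, fun _ _ => 0, fun i => (B i).zero_mem _, fun y => by simp⟩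
  sup_mem x φ₁ h₁ φ₂ h₂ ε hε ω hω := by
    classical
    obtain ⟨K₁, ψ₁, m₁, l₁⟩ := h₁ ε hε ω hω
    obtain ⟨K₂, ψ₂, m₂, l₂⟩ := h₂ ε hε ω hω
    refine ⟨K₁ ∪ K₂, fun i => ψ₁ i ⊔ ψ₂ i, fun i => (B i).sup_mem _ _ (m₁ i) _ (m₂ i),
      fun y => ?_⟩
    have e : min ((φ₁ ⊔ φ₂) y) ω = max (min (φ₁ y) ω) (min (φ₂ y) ω) := by
      exact inf_sup_right (φ₁ y) (φ₂ y) ω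
    rw [e]
    refine max_le ((l₁ y).trans ?_) ((l₂ y).trans ?_)
    · refine add_le_add_left (Finset.sup_le fun i hi => ?_) _
      exact le_trans (le_max_left (ψ₁ i (f i y)) (ψ₂ i (f i y)))
        (Finset.le_sup (f := fun i => (ψ₁ i ⊔ ψ₂ i) (f i y)) (Finset.mem_union_left _ hi))
    · refine add_le_add_left (Finset.sup_le fun i hi => ?_) _
      exact le_trans (le_max_right (ψ₁ i (f i y)) (ψ₂ i (f i y)))
        (Finset.le_sup (f := fun i => (ψ₁ i ⊔ ψ₂ i) (f i y)) (Finset.mem_union_right _ hi))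
  lower x φ hφ φ' h ε hε ω hω := by
    obtain ⟨K, ψ, m, l⟩ := hφ ε hε ω hω
    exact ⟨K, ψ, m, fun y => (min_le_min_right _ (h y)).trans (l y)⟩
  apply_self x φ hφ := by
    refine le_antisymm (ENNReal.le_of_forall_pos_le_add fun ε hε _ => ?_) zero_le
    obtain ⟨K, ψ, m, l⟩ := hφ (min (ε : ℝ≥0∞) 1) (by simpa using hε) 2 (by simp)
    have h0 : (K.sup fun i => ψ i (f i x)) = 0 :=
      le_antisymm (Finset.sup_le fun i _ => ((B i).apply_self _ _ (m i)).le) zero_le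
    have h1 := l x
    rw [h0] at h1
    rcases min_le_iff.1 h1 with h3 | h3
    · exact h3.trans (add_le_add_right (min_le_left _ _) _)
    · refine absurd h3 (not_le.2 ?_)
      rw [zero_add]
      exact (min_le_right _ _).trans_lt ENNReal.one_lt_two
  saturated x φ h ε hε ω hω := by
    have hε2 : 0 < ε / 2 := ENNReal.half_pos hε.ne'
    obtain ⟨φ', h', l'⟩ := h (ε / 2) hε2 ω hω
    obtain ⟨K, ψ, m, l⟩ := h' (ε / 2) hε2 ω hω
    refine ⟨K, ψ, m, fun y => ?_⟩
    have h1 : min (φ y) ω ≤ min (φ' y) ω + ε / 2 := by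
      rcases le_total (φ' y) ω with h2 | h2
      · rw [min_eq_left h2]
        exact l' y
      · rw [min_eq_right h2]
        exact (min_le_right _ _).trans le_self_add
    calc min (φ y) ω ≤ min (φ' y) ω + ε / 2 := h1
      _ ≤ (K.sup fun i => ψ i (f i y)) + ε / 2 + ε / 2 := add_le_add_left (l y) _
      _ = (K.sup fun i => ψ i (f i y)) + ε := by rw [add_assoc, ENNReal.add_halves]
  triangle x φ hφ ε hε ω hω := by
    have hε2 : 0 < ε / 2 := ENNReal.half_pos hε.ne'
    obtain ⟨K, ψ, m, l⟩ := hφ (ε / 2) hε2 ω hω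
    choose Ψ hΨ hl using fun i => (B i).triangle (f i x) (ψ i) (m i) (ε / 2) hε2 ω hω
    refine ⟨fun z y => K.sup fun i => Ψ i (f i z) (f i y), fun z ε' _ ω' _ =>
      ⟨K, fun i => Ψ i (f i z), fun i => hΨ i _, fun y => (min_le_left _ _).trans le_self_add⟩,
      fun y z => ?_⟩
    have h1 : min (φ y) ω ≤ min (K.sup fun i => ψ i (f i y)) ω + ε / 2 := by
      rcases le_total (K.sup fun i => ψ i (f i y)) ω with h2 | h2
      · rw [min_eq_left h2]
        exact l y
      · rw [min_eq_right h2]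
        exact (min_le_right _ _).trans le_self_add
    have h2 : min (K.sup fun i => ψ i (f i y)) ω ≤
        (K.sup fun i => Ψ i (f i x) (f i z)) + (K.sup fun i => Ψ i (f i z) (f i y)) + ε / 2 := by
      refine (Finset.sup_inf_distrib_right K (fun i => ψ i (f i y)) ω).le.trans ?_
      refine Finset.sup_le fun i hi => (hl i (f i y) (f i z)).trans ?_
      exact add_le_add_left (add_le_add
        (Finset.le_sup (f := fun i => Ψ i (f i x) (f i z)) hi)
        (Finset.le_sup (f := fun i => Ψ i (f i z) (f i y)) hi)) _
    calc min (φ y) ω ≤ min (K.sup fun i => ψ i (f i y)) ω + ε / 2 := h1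
      _ ≤ _ + ε / 2 := add_le_add_left h2 _
      _ = _ := by rw [add_assoc, ENNReal.add_halves]

/-- All maps of the source are contractions for the initial structure. -/
theorem initial_isContraction {ι X : Type*} {Y : ι → Type*} (B : ∀ i, ApproachSystem (Y i))
    (f : ∀ i, X → Y i) (i : ι) : (initial B f).IsContraction (B i) (f i) := by
  classical
  intro x ψ hψ ε _ ω _
  refine ⟨{i}, fun j => if h : i = j then h ▸ ψ else fun _ => 0, fun j => ?_, fun y => ?_⟩
  · by_cases h : i = j
    · subst h
      simpa using hψ
    · simpa [h] using (B j).zero_mem _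
  · simp

/-- The initial structure is the coarsest one for which all maps of the source are
contractions. -/
theorem initial_coarsest {ι X : Type*} {Y : ι → Type*} (B : ∀ i, ApproachSystem (Y i))
    (f : ∀ i, X → Y i) (A : ApproachSystem X) (hA : ∀ i, A.IsContraction (B i) (f i)) (x : X) :
    (initial B f).sys x ⊆ A.sys x := by
  classical
  intro φ hφ
  refine A.saturated x φ fun ε hε ω hω => ?_
  obtain ⟨K, ψ, m, l⟩ := hφ ε hε ω hω
  refine ⟨fun y => K.sup fun i => ψ i (f i y), ?_, l⟩
  clear l
  induction K using Finset.induction_on with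
  | empty => simpa using A.zero_mem x
  | insert i K _ ih =>
    have := A.sup_mem x _ (hA i x (ψ i) (m i)) _ ih
    simpa [Finset.sup_insert, Pi.sup_def, Function.comp_def] using this

variable {X : Type*}

/-- The ball with radius `ε` of a local distance `φ`. -/
def ball (φ : X → ℝ≥0∞) (ε : ℝ≥0∞) : Set X := {y | φ y < ε}

/-- The sequence `a` is `ε`-convergent to `x`: each ball with center `x` and radius `ε` contains
`a n` for all large `n`. -/
def EpsConvergesTo (A : ApproachSystem X) (ε : ℝ≥0∞) (a : ℕ → X) (x : X) : Prop :=
  ∀ φ ∈ A.sys x, ∀ᶠ n in atTop, a n ∈ ball φ ε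

/-- Every sequence in `D` contains a subsequence which is `ε`-convergent to a point of `X`. -/
def IsEpsRelSeqCompact (A : ApproachSystem X) (ε : ℝ≥0∞) (D : Set X) : Prop :=
  ∀ a : ℕ → X, (∀ n, a n ∈ D) →
    ∃ k : ℕ → ℕ, StrictMono k ∧ ∃ x, A.EpsConvergesTo ε (a ∘ k) x

/-- For every choice `Φ` of a local distance at each point of `X`, the set `D` can be covered
with finitely many `Φ`-balls with radius `ε`. -/
def IsEpsRelCompact (A : ApproachSystem X) (ε : ℝ≥0∞) (D : Set X) : Prop :=
  ∀ Φ : X → X → ℝ≥0∞, (∀ x, Φ x ∈ A.sys x) →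
    ∃ t : Finset X, D ⊆ ⋃ x ∈ t, ball (Φ x) ε

/-- The relative sequential compactness index. -/
noncomputable def chiRsc (A : ApproachSystem X) (D : Set X) : ℝ≥0∞ :=
  sInf {α | 0 < α ∧ α ≠ ⊤ ∧ A.IsEpsRelSeqCompact α D}

/-- The relative compactness index. -/
noncomputable def chiRc (A : ApproachSystem X) (D : Set X) : ℝ≥0∞ :=
  sInf {α | 0 < α ∧ α ≠ ⊤ ∧ A.IsEpsRelCompact α D}

end ApproachSystem

/-- Cumulative distribution functions on the real line. -/
structure Cdf extends StieltjesFunction ℝ where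
  tendsto_atBot' : Tendsto toFun atBot (𝓝 0)
  tendsto_atTop' : Tendsto toFun atTop (𝓝 1)

namespace Cdf

instance : CoeFun Cdf fun _ => ℝ → ℝ := ⟨fun F => F.toStieltjesFunction⟩

theorem mono (F : Cdf) : Monotone F := F.toStieltjesFunction.mono

theorem tendsto_atBot (F : Cdf) : Tendsto F atBot (𝓝 0) := F.tendsto_atBot'

theorem tendsto_atTop (F : Cdf) : Tendsto F atTop (𝓝 1) := F.tendsto_atTop'

theorem nonneg (F : Cdf) (x : ℝ) : 0 ≤ F x := F.mono.le_of_tendsto F.tendsto_atBot x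

theorem le_one (F : Cdf) (x : ℝ) : F x ≤ 1 := F.mono.ge_of_tendsto F.tendsto_atTop x

theorem norm_le_one (F : Cdf) (x : ℝ) : ‖F x‖ ≤ 1 := by
  rw [Real.norm_of_nonneg (F.nonneg x)]
  exact F.le_one x

/-- The Lebesgue–Stieltjes probability measure `dF` of a cdf `F`. -/
noncomputable def measure (F : Cdf) : Measure ℝ := F.toStieltjesFunction.measure

instance (F : Cdf) : IsProbabilityMeasure F.measure :=
  F.toStieltjesFunction.isProbabilityMeasure F.tendsto_atBot F.tendsto_atTop

theorem measurable_sub (F : Cdf) (x : ℝ) : Measurable fun y => F (x - y) :=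
  F.mono.measurable.comp (measurable_const.sub measurable_id)

theorem integrable_sub (F G : Cdf) (x : ℝ) : Integrable (fun y => F (x - y)) G.measure :=
  Integrable.of_bound (F.measurable_sub x).aestronglyMeasurable 1
    (Eventually.of_forall fun _ => F.norm_le_one _)

/-- Dominated convergence for the integrals that define the convolution product. -/
theorem tendsto_integral_sub (F G : Cdf) {l : Filter ℝ} [l.IsCountablyGenerated] {c : ℝ → ℝ}
    (h : ∀ᵐ y ∂G.measure, Tendsto (fun x => F (x - y)) l (𝓝 (c y))) :
    Tendsto (fun x => ∫ y, F (x - y) ∂G.measure) l (𝓝 (∫ y, c y ∂G.measure)) :=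
  tendsto_integral_filter_of_dominated_convergence (fun _ => (1 : ℝ))
    (Eventually.of_forall fun x => (F.measurable_sub x).aestronglyMeasurable)
    (Eventually.of_forall fun _ => Eventually.of_forall fun _ => F.norm_le_one _)
    (integrable_const _) h

/-- The convolution product `(F ⋆ G)(x) = ∫ F(x - y) dG(y)`. -/
noncomputable def conv (F G : Cdf) : Cdf where
  toFun x := ∫ y, F (x - y) ∂G.measure
  mono' a b hab := integral_mono (F.integrable_sub G a) (F.integrable_sub G b)
    fun y => F.mono (sub_le_sub_right hab y)
  right_continuous' x := F.tendsto_integral_sub G (Eventually.of_forall fun y =>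
    (F.toStieltjesFunction.right_continuous (x - y)).tendsto.comp
      (tendsto_nhdsWithin_of_tendsto_nhds_of_eventually_within _
        (((continuous_id.sub continuous_const).tendsto x).mono_left nhdsWithin_le_nhds)
        (eventually_nhdsWithin_of_forall fun _ hz => sub_le_sub_right hz y)))
  tendsto_atBot' := by
    simpa using F.tendsto_integral_sub G (c := fun _ => 0) (Eventually.of_forall fun y =>
      F.tendsto_atBot.comp (tendsto_atBot_add_const_right _ (-y) tendsto_id))
  tendsto_atTop' := by
    simpa using F.tendsto_integral_sub G (c := fun _ => 1) (Eventually.of_forall fun y =>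
      F.tendsto_atTop.comp (tendsto_atTop_add_const_right _ (-y) tendsto_id))

/-- `F ⋆ G` is continuous if `G` is. -/
theorem continuous_conv (F G : Cdf) (hG : Continuous G) : Continuous (F.conv G) := by
  refine continuous_iff_continuousAt.2 fun x => F.tendsto_integral_sub G ?_
  have : NullSingletonClass G.measure := ⟨fun a => by
    have h : Function.leftLim G.toStieltjesFunction a = G a :=
      (hG.continuousAt (x := a)).continuousWithinAt.leftLim_eq
    rw [measure, StieltjesFunction.measure_singleton, h, sub_self, ENNReal.ofReal_zero]⟩
  have hc : {y | ¬ ContinuousAt F (x - y)}.Countable :=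
    F.mono.countable_not_continuousAt.preimage (sub_right_injective (b := x))
  filter_upwards [hc.ae_notMem G.measure] with y hy
  have hy' : ContinuousAt F (x - y) := not_not.1 hy
  exact hy'.tendsto.comp ((continuous_id.sub continuous_const).tendsto x)

/-- The weak topology: the initial topology for the maps `F ↦ ∫ h dF`, with `h` running through
the bounded continuous functions. -/
noncomputable instance weakTopology : TopologicalSpace Cdf :=
  ⨅ h : ℝ →ᵇ ℝ, TopologicalSpace.induced (fun F : Cdf => ∫ x, h x ∂F.measure) inferInstance

/-- Each sequence in `D` contains a weakly convergent subsequence (the limit being a cdf, not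
necessarily in `D`). -/
def IsWeaklyRelSeqCompact (D : Set Cdf) : Prop :=
  ∀ a : ℕ → Cdf, (∀ n, a n ∈ D) →
    ∃ k : ℕ → ℕ, StrictMono k ∧ ∃ F : Cdf, Tendsto (a ∘ k) atTop (𝓝 F)

end Cdf

/-- Continuous cumulative distribution functions. -/
def ContCdf : Type := {F : Cdf // Continuous F}

namespace ContCdf

/-- The uniform distance `sup_x |F x - G x|`. -/
noncomputable def uniformDist (F G : ContCdf) : ℝ≥0∞ :=
  ⨆ x : ℝ, ENNReal.ofReal |F.1 x - G.1 x|

/-- The approach structure underlying the uniform distance. -/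
noncomputable def uniformApproach : ApproachSystem ContCdf :=
  ApproachSystem.ofMetric uniformDist (fun F => by simp [uniformDist]) fun F G H =>
    iSup_le fun x =>
      calc ENNReal.ofReal |F.1 x - H.1 x|
          ≤ ENNReal.ofReal (|F.1 x - G.1 x| + |G.1 x - H.1 x|) :=
            ENNReal.ofReal_le_ofReal (abs_sub_le _ _ _)
        _ ≤ ENNReal.ofReal |F.1 x - G.1 x| + ENNReal.ofReal |G.1 x - H.1 x| :=
            ENNReal.ofReal_add_le
        _ ≤ uniformDist F G + uniformDist G H :=
            add_le_add (le_iSup (fun x => ENNReal.ofReal |F.1 x - G.1 x|) x)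
              (le_iSup (fun x => ENNReal.ofReal |G.1 x - H.1 x|) x)

end ContCdf

/-- The continuity approach structure on the set of cdfs: the initial approach structure for the
source of all maps `F ↦ F ⋆ G` into the continuous cdfs with the uniform distance, with `G`
running through the continuous cdfs. -/
noncomputable def continuityApproach : ApproachSystem Cdf :=
  ApproachSystem.initial (fun _ : ContCdf => ContCdf.uniformApproach)
    fun G F => ⟨F.conv G.1, F.continuous_conv G.1 G.2⟩

/-!
Both indices equal the *escaping mass* of `D`, the limit for `M → ∞` of the largest mass that a
member of `D` puts in one of the tails outside `[-M, M]`. If `F ⋆ U` and `H ⋆ U`, with `U` the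
uniform distribution on `[0, 1]`, have uniform distance at most `α`, then the tails of `H` exceed
those of `F` by at most `α`, after a shift by `1`; hence the escaping mass is at most `α` if `D` is
covered by finitely many such balls, or if each sequence in `D` has an `α`-convergent subsequence.
Conversely, a pointwise limit of elements of `D` along an ultrafilter lacks at most the escaping
mass `m` at `-∞` and at `∞`. Moving the missing mass to the origin yields a cdf `F` all of whose
Lévy neighbourhoods, relaxed by a vertical error `m`, belong to the ultrafilter; since the functions
`F ⋆ G` with `G` continuous are uniformly continuous, every local distance at `F` is eventually
below each `α > m`. For `m = 0` these neighbourhoods generate the weak topology.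
-/

open scoped NNReal

theorem sInf_setOf_pos_ne_top_eq {P : ℝ≥0∞ → Prop} {m : ℝ≥0∞}
    (of_lt : ∀ α ≠ ⊤, m < α → P α) (le_of : ∀ α ≠ ⊤, P α → m ≤ α) :
    sInf {α | 0 < α ∧ α ≠ ⊤ ∧ P α} = m := by
  refine le_antisymm (le_of_forall_gt_imp_ge_of_dense fun α hα => ?_)
    (le_sInf fun α hα => le_of α hα.2.1 hα.2.2)
  obtain ⟨β, hmβ, hβα⟩ := exists_between hα
  have hβ : β ∈ {α | 0 < α ∧ α ≠ ⊤ ∧ P α} := ⟨pos_of_gt hmβ, hβα.ne_top, of_lt β hβα.ne_top hmβ⟩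
  exact (sInf_le hβ).trans hβα.le

namespace ApproachSystem

theorem limsup_le_of_mem_sys_initial {ι X : Type*} {Y : ι → Type*} {B : ∀ i, ApproachSystem (Y i)}
    {f : ∀ i, X → Y i} {l : Filter X} {x : X} {c : ℝ≥0∞}
    (h : ∀ i, ∀ ψ ∈ (B i).sys (f i x), limsup (fun y => ψ (f i y)) l ≤ c)
    {φ : X → ℝ≥0∞} (hφ : φ ∈ (initial B f).sys x) : limsup φ l ≤ c := by
  refine le_of_forall_gt_imp_ge_of_dense fun c' hc' => ?_
  obtain ⟨d, hcd, hdc'⟩ := exists_between hc'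
  obtain ⟨e, hde, hec'⟩ := exists_between hdc'
  obtain ⟨K, ψ, hψ, hφψ⟩ := hφ (e - d) (tsub_pos_of_lt hde) e hec'.ne_top
  have hK : ∀ᶠ y in l, ∀ i ∈ K, ψ i (f i y) < d := (eventually_all_finset K).2 fun i _ =>
    eventually_lt_of_limsup_lt ((h i _ (hψ i)).trans_lt hcd)
  refine limsup_le_of_le (h := hK.mono fun y hy => ?_)
  have hlt : min (φ y) e < e := calc
    min (φ y) e ≤ (K.sup fun i => ψ i (f i y)) + (e - d) := hφψ y
    _ < d + (e - d) := ENNReal.add_lt_add_right (by finiteness)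
      ((Finset.sup_lt_iff (pos_of_gt hcd)).2 hy)
    _ = e := add_tsub_cancel_of_le hde.le
  exact ((min_lt_iff.1 hlt).resolve_right (lt_irrefl e)).le.trans hec'.le

theorem isEpsRelCompact_of_forall_ultrafilter {X : Type*} {A : ApproachSystem X} {ε : ℝ≥0∞}
    {D : Set X} (h : ∀ U : Ultrafilter X, D ∈ U → ∃ x, ∀ φ ∈ A.sys x, ball φ ε ∈ U) :
    A.IsEpsRelCompact ε D := by
  classical
  intro Φ hΦ
  by_contra! hcover
  let rest (t : Finset X) : Set X := D \ ⋃ x ∈ t, ball (Φ x) ε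
  have rest_antitone : Antitone rest := fun _ _ hts =>
    sdiff_subset_sdiff_right (biUnion_subset_biUnion_left hts)
  have : NeBot (⨅ t, 𝓟 (rest t)) := iInf_neBot_of_directed'
    (directed_of_isDirected_le fun _ _ hts => principal_mono.2 (rest_antitone hts))
    fun t => principal_neBot_iff.2 (sdiff_nonempty.2 (hcover t))
  obtain ⟨U, hU⟩ := Ultrafilter.exists_le (⨅ t, 𝓟 (rest t))
  have rest_mem (t : Finset X) : rest t ∈ U := hU (mem_iInf_of_mem t (mem_principal_self _))
  obtain ⟨x, hx⟩ := h U (mem_of_superset (rest_mem ∅) sdiff_subset)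
  obtain ⟨y, hyx, hy⟩ := U.nonempty_of_mem (inter_mem (hx (Φ x) (hΦ x)) (rest_mem {x}))
  exact hy.2 (mem_iUnion₂.2 ⟨x, Finset.mem_singleton_self x, hyx⟩)

end ApproachSystem

namespace Cdf

/-- Two cdfs are `(δ, η)`-close if each is dominated by the other after a horizontal shift by `δ`
and a vertical shift by `η`. The Lévy distance is the infimum of all `δ` for which they are
`(δ, δ)`-close. -/
def LevyClose (δ η : ℝ) (F H : Cdf) : Prop :=
  ∀ x, F x ≤ H (x + δ) + η ∧ H x ≤ F (x + δ) + η

theorem LevyClose.mono {δ δ' η η' : ℝ} {F H : Cdf} (h : LevyClose δ η F H) (hδ : δ ≤ δ')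
    (hη : η ≤ η') : LevyClose δ' η' F H := fun x =>
  ⟨(h x).1.trans (add_le_add (H.mono (by gcongr)) hη),
    (h x).2.trans (add_le_add (F.mono (by gcongr)) hη)⟩

theorem conv_le_conv_add {F H : Cdf} {δ η : ℝ} (h : ∀ x, F x ≤ H (x + δ) + η) (G : Cdf) (x : ℝ) :
    F.conv G x ≤ H.conv G (x + δ) + η := calc
  F.conv G x ≤ ∫ y, (H (x + δ - y) + η) ∂G.measure :=
    integral_mono (F.integrable_sub G x) ((H.integrable_sub G _).add (integrable_const η))
      fun y => by simpa only [sub_add_eq_add_sub] using h (x - y)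
  _ = H.conv G (x + δ) + η := by
    rw [integral_add (H.integrable_sub G _) (integrable_const η)]
    simp [conv]

theorem LevyClose.conv {δ η : ℝ} {F H : Cdf} (h : LevyClose δ η F H) (G : Cdf) :
    LevyClose δ η (F.conv G) (H.conv G) := fun x =>
  ⟨conv_le_conv_add (fun y => (h y).1) G x, conv_le_conv_add (fun y => (h y).2) G x⟩

theorem LevyClose.abs_sub_le {δ η ε : ℝ} {F H : Cdf} (h : LevyClose δ η F H)
    (hF : ∀ x, F (x + δ) ≤ F x + ε) (x : ℝ) : |F x - H x| ≤ η + ε := by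
  have hF_left := hF (x - δ)
  have h_left := (h (x - δ)).1
  rw [sub_add_cancel] at hF_left h_left
  rw [_root_.abs_sub_le_iff]
  constructor <;> linarith [hF x, (h x).2]

/-- The `m`-defective Lévy neighbourhood filter of `F`: for `m = 0` it is generated by the balls of
the Lévy metric around `F`, and `m` is an additional vertical error that need not vanish. -/
def levyNhds (m : ℝ≥0) (F : Cdf) : Filter Cdf :=
  ⨅ δ ∈ Ioi (0 : ℝ), 𝓟 {H | LevyClose δ (m + δ) F H}

theorem hasBasis_levyNhds (m : ℝ≥0) (F : Cdf) :
    (levyNhds m F).HasBasis (fun δ : ℝ => 0 < δ) fun δ => {H | LevyClose δ (m + δ) F H} := by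
  refine hasBasis_biInf_principal (fun δ hδ δ' hδ' => ?_) nonempty_Ioi
  refine ⟨min δ δ', mem_Ioi.2 (lt_min hδ hδ'), fun H hH => hH.mono ?_ ?_,
    fun H hH => hH.mono ?_ ?_⟩ <;> simp

instance (m : ℝ≥0) (F : Cdf) : (levyNhds m F).IsCountablyGenerated := by
  have hbasis : (levyNhds m F).HasBasis (fun _ : ℕ => True)
      fun n => {H | LevyClose (1 / (n + 1)) (m + 1 / (n + 1)) F H} :=
    (hasBasis_levyNhds m F).to_hasBasis
      (fun δ hδ => (exists_nat_one_div_lt hδ).imp fun n hn =>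
        ⟨trivial, fun H hH => hH.mono hn.le (by gcongr)⟩)
      fun n _ => ⟨1 / (n + 1), by positivity, Subset.rfl⟩
  exact hbasis.isCountablyGenerated

theorem eventually_levyClose {δ : ℝ} (hδ : 0 < δ) (m : ℝ≥0) (F : Cdf) :
    ∀ᶠ H in levyNhds m F, LevyClose δ (m + δ) F H :=
  (hasBasis_levyNhds m F).mem_of_mem hδ

/-- The cdf of the uniform distribution on `[0, 1]`. It serves as a smoothing kernel. -/
noncomputable def uniformUnit : Cdf where
  toFun x := max 0 (min 1 x)
  mono' _ _ h := max_le_max le_rfl (min_le_min le_rfl h)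
  right_continuous' x := (by fun_prop : Continuous fun x : ℝ => max 0 (min 1 x)).continuousWithinAt
  tendsto_atBot' := tendsto_const_nhds.congr' ((eventually_le_atBot 0).mono fun x hx => by
    simp [min_eq_right (hx.trans zero_le_one), max_eq_left hx])
  tendsto_atTop' := tendsto_const_nhds.congr' ((eventually_ge_atTop 1).mono fun x hx => by
    simp [min_eq_left hx])

theorem uniformContinuous_uniformUnit : UniformContinuous uniformUnit :=
  ((LipschitzWith.id.const_min 1).const_max 0).uniformContinuous

theorem uniformContinuous_of_continuous {F : Cdf} (hF : Continuous F) : UniformContinuous F := by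
  have hdiff : Tendsto (fun x => F x - uniformUnit x) (cocompact ℝ) (𝓝 0) := by
    rw [cocompact_eq_atBot_atTop, tendsto_sup]
    exact ⟨by simpa using F.tendsto_atBot.sub uniformUnit.tendsto_atBot,
      by simpa using F.tendsto_atTop.sub uniformUnit.tendsto_atTop⟩
  have h := (hF.sub uniformContinuous_uniformUnit.continuous).uniformContinuous_of_tendsto_cocompact
    hdiff
  simpa using h.add uniformContinuous_uniformUnit

theorem exists_forall_add_le {F : Cdf} (hF : Continuous F) {ε : ℝ} (hε : 0 < ε) :
    ∃ δ > 0, ∀ x, F (x + δ) ≤ F x + ε := by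
  obtain ⟨δ, hδ, h⟩ := Metric.uniformContinuous_iff.1 (uniformContinuous_of_continuous hF) ε hε
  refine ⟨δ / 2, half_pos hδ, fun x => ?_⟩
  have hx : dist (F (x + δ / 2)) (F x) < ε := h (by simpa [abs_of_pos hδ] using half_lt_self hδ)
  rw [Real.dist_eq] at hx
  linarith [(abs_lt.1 hx).2]

/-- The map `F ↦ F ⋆ G` from the cdfs to the continuous cdfs. The maps of this form generate the
continuity approach structure. -/
noncomputable def smooth (G : ContCdf) (F : Cdf) : ContCdf :=
  ⟨F.conv G.1, F.continuous_conv G.1 G.2⟩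

theorem limsup_uniformDist_smooth_le (m : ℝ≥0) (F : Cdf) (G : ContCdf) :
    limsup (fun H => (smooth G F).uniformDist (smooth G H)) (levyNhds m F) ≤ m := by
  refine ENNReal.le_of_forall_pos_le_add fun ε hε _ => ?_
  have hε2 : (0 : ℝ) < ε / 2 := half_pos (by exact_mod_cast hε)
  obtain ⟨δ, hδ, hcont⟩ := exists_forall_add_le (F.continuous_conv G.1 G.2) hε2
  have hev := eventually_levyClose (lt_min hδ hε2) m F
  refine limsup_le_of_le (h := hev.mono fun H hH => iSup_le fun x => ?_)
  have hHG : LevyClose δ (m + ε / 2) (F.conv G.1) (H.conv G.1) :=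
    (hH.conv G.1).mono (min_le_left _ _) (by gcongr; exact min_le_right _ _)
  have hx : |F.conv G.1 x - H.conv G.1 x| ≤ ((m + ε : ℝ≥0) : ℝ) := by
    push_cast
    linarith [hHG.abs_sub_le hcont x]
  rw [← ENNReal.coe_add, ← ENNReal.ofReal_coe_nnreal]
  exact ENNReal.ofReal_le_ofReal hx

theorem eventually_lt_of_mem_sys {F : Cdf} {φ : Cdf → ℝ≥0∞} (hφ : φ ∈ continuityApproach.sys F)
    {m : ℝ≥0} {α : ℝ≥0∞} (hm : m < α) : ∀ᶠ H in levyNhds m F, φ H < α := by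
  have hψ (G : ContCdf) (ψ) (hψ : ψ ≤ (smooth G F).uniformDist) :
      limsup (fun H => ψ (smooth G H)) (levyNhds m F) ≤ m :=
    (limsup_le_limsup (Eventually.of_forall fun H => hψ (smooth G H))).trans
      (limsup_uniformDist_smooth_le m F G)
  exact eventually_lt_of_limsup_lt
    ((ApproachSystem.limsup_le_of_mem_sys_initial hψ hφ).trans_lt hm)

theorem ae_mem_Ioc_uniformUnit : ∀ᵐ y ∂uniformUnit.measure, y ∈ Ioc (0 : ℝ) 1 := by
  have h : uniformUnit.measure (Ioc 0 1) = 1 := by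
    rw [measure, StieltjesFunction.measure_Ioc]
    simp [uniformUnit]
  exact (prob_compl_eq_zero_iff measurableSet_Ioc).2 h

theorem conv_uniformUnit_le (H : Cdf) (x : ℝ) : H.conv uniformUnit x ≤ H x := calc
  H.conv uniformUnit x ≤ ∫ _, H x ∂uniformUnit.measure :=
    integral_mono_ae (H.integrable_sub _ x) (integrable_const _)
      (ae_mem_Ioc_uniformUnit.mono fun y hy => H.mono (by linarith [hy.1]))
  _ = H x := by simp

theorem le_conv_uniformUnit (H : Cdf) (x : ℝ) : H (x - 1) ≤ H.conv uniformUnit x := calc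
  H (x - 1) = ∫ _, H (x - 1) ∂uniformUnit.measure := by simp
  _ ≤ H.conv uniformUnit x :=
    integral_mono_ae (integrable_const _) (H.integrable_sub _ x)
      (ae_mem_Ioc_uniformUnit.mono fun y hy => H.mono (by linarith [hy.2]))

/-- The uniform distance of two cdfs after smoothing with the uniform distribution on `[0, 1]`. -/
noncomputable def smoothDist (F H : Cdf) : ℝ≥0∞ :=
  let U : ContCdf := ⟨uniformUnit, uniformContinuous_uniformUnit.continuous⟩
  (smooth U F).uniformDist (smooth U H)

theorem smoothDist_mem_sys (F : Cdf) : smoothDist F ∈ continuityApproach.sys F :=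
  let U : ContCdf := ⟨uniformUnit, uniformContinuous_uniformUnit.continuous⟩
  ApproachSystem.initial_isContraction (fun _ : ContCdf => ContCdf.uniformApproach) smooth U F
    (smooth U F).uniformDist fun _ => le_rfl

theorem levyClose_of_smoothDist_le {F H : Cdf} {α : ℝ≥0} (h : smoothDist F H ≤ α) :
    LevyClose 1 α F H := by
  have hdiff (x : ℝ) : |F.conv uniformUnit x - H.conv uniformUnit x| ≤ α :=
    ENNReal.ofReal_le_coe.1 (iSup_le_iff.1 h x)
  intro x
  have hx := abs_le.1 (hdiff (x + 1))
  have hF := F.le_conv_uniformUnit (x + 1)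
  have hH := H.le_conv_uniformUnit (x + 1)
  rw [add_sub_cancel_right] at hF hH
  constructor <;>
    linarith [hx.1, hx.2, F.conv_uniformUnit_le (x + 1), H.conv_uniformUnit_le (x + 1)]

/-- A measure for the mass that `H` puts outside `[-M, M]`: the larger one of the two tails. -/
noncomputable def tailMass (H : Cdf) (M : ℝ) : ℝ :=
  max (H (-M)) (1 - H M)

theorem tailMass_le_iff {H : Cdf} {M c : ℝ} : H.tailMass M ≤ c ↔ H (-M) ≤ c ∧ 1 - H M ≤ c :=
  max_le_iff

theorem antitone_tailMass (H : Cdf) : Antitone H.tailMass := fun _ _ h =>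
  max_le_max (H.mono (neg_le_neg h)) (sub_le_sub_left (H.mono h) 1)

/-- The mass that the cdfs in `D` can lose at infinity. The set `D` is tight if and only if its
escaping mass is zero. -/
noncomputable def escapingMass (D : Set Cdf) : ℝ≥0∞ :=
  ⨅ M : ℝ, ⨆ H ∈ D, ENNReal.ofReal (H.tailMass M)

theorem escapingMass_le_of_forall_tailMass_le {D : Set Cdf} {M : ℝ} {c : ℝ≥0}
    (h : ∀ H ∈ D, H.tailMass M ≤ c) : escapingMass D ≤ c :=
  iInf_le_of_le M (iSup₂_le fun H hH => ENNReal.ofReal_le_coe.2 (h H hH))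

theorem exists_forall_tailMass_lt {D : Set Cdf} {c : ℝ≥0} (h : escapingMass D < c) :
    ∃ M, ∀ H ∈ D, H.tailMass M < c := by
  obtain ⟨M, hM⟩ := iInf_lt_iff.1 h
  refine ⟨M, fun H hH => ?_⟩
  have hlt : ENNReal.ofReal (H.tailMass M) < c :=
    (le_iSup₂ (f := fun (H : Cdf) (_ : H ∈ D) => ENNReal.ofReal (H.tailMass M)) H hH).trans_lt hM
  rw [← ENNReal.ofReal_coe_nnreal] at hlt
  exact (ENNReal.ofReal_lt_ofReal_iff'.1 hlt).1

theorem escapingMass_ne_top (D : Set Cdf) : escapingMass D ≠ ⊤ := by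
  have h : escapingMass D ≤ (1 : ℝ≥0) :=
    escapingMass_le_of_forall_tailMass_le (M := 0) fun H _ =>
      tailMass_le_iff.2 ⟨H.le_one _, by simpa using H.nonneg 0⟩
  exact ne_top_of_le_ne_top ENNReal.coe_ne_top h

theorem LevyClose.tailMass_le {δ η : ℝ} {F H : Cdf} (h : LevyClose δ η F H) (M : ℝ) :
    H.tailMass M ≤ F.tailMass (M - δ) + η := by
  have hbot : H (-M) ≤ F (-(M - δ)) + η := by simpa [add_comm, sub_eq_add_neg] using (h (-M)).2
  have htop : F (M - δ) ≤ H M + η := by simpa using (h (M - δ)).1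
  have hF := tailMass_le_iff.1 (le_refl (F.tailMass (M - δ)))
  exact tailMass_le_iff.2 ⟨by linarith [hF.1], by linarith [hF.2]⟩

theorem tendsto_tailMass (F : Cdf) : Tendsto F.tailMass atTop (𝓝 0) := by
  have h := (F.tendsto_atBot.comp tendsto_neg_atTop_atBot).max (F.tendsto_atTop.const_sub 1)
  rwa [sub_self, max_self] at h

theorem eventually_forall_tailMass_le (F : Cdf) (δ : ℝ) {η β : ℝ} (hβ : η < β) :
    ∀ᶠ M in atTop, ∀ H, LevyClose δ η F H → H.tailMass M ≤ β := by
  have h := F.tendsto_tailMass.comp (tendsto_atTop_add_const_right atTop (-δ) tendsto_id)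
  filter_upwards [h.eventually (gt_mem_nhds (sub_pos.2 hβ))] with M hM H hH
  have hM' : F.tailMass (M - δ) < β - η := hM
  linarith [hH.tailMass_le M]

theorem escapingMass_le_of_forall_seq {D : Set Cdf} {δ : ℝ} {η : ℝ≥0}
    (h : ∀ a : ℕ → Cdf, (∀ n, a n ∈ D) → ∃ k : ℕ → ℕ, StrictMono k ∧
      ∃ F, ∀ᶠ n in atTop, LevyClose δ η F (a (k n))) :
    escapingMass D ≤ η := by
  refine le_of_forall_gt_imp_ge_of_dense fun γ hγ => ?_
  obtain ⟨β, hηβ, hβγ⟩ := ENNReal.lt_iff_exists_nnreal_btwn.1 hγ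
  refine le_trans ?_ hβγ.le
  by_contra! hβ
  have (n : ℕ) : ∃ H ∈ D, β < H.tailMass n := by
    by_contra! hn
    exact hβ.not_ge (escapingMass_le_of_forall_tailMass_le hn)
  choose a haD ha using this
  obtain ⟨k, hk, F, hF⟩ := h a haD
  obtain ⟨M, hM⟩ := (eventually_forall_tailMass_le F δ (by exact_mod_cast hηβ)).exists
  obtain ⟨n, hFn, hMn⟩ := (hF.and
    ((tendsto_natCast_atTop_atTop.comp hk.tendsto_atTop).eventually_ge_atTop M)).exists
  exact (ha (k n)).not_ge (((a (k n)).antitone_tailMass hMn).trans (hM _ hFn))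

theorem escapingMass_le_of_isEpsRelSeqCompact {D : Set Cdf} {α : ℝ≥0}
    (h : continuityApproach.IsEpsRelSeqCompact α D) : escapingMass D ≤ α :=
  escapingMass_le_of_forall_seq fun a ha => by
    obtain ⟨k, hk, F, hF⟩ := h a ha
    exact ⟨k, hk, F, (hF _ (smoothDist_mem_sys F)).mono fun n hn =>
      levyClose_of_smoothDist_le hn.le⟩

theorem escapingMass_le_of_isEpsRelCompact {D : Set Cdf} {α : ℝ≥0}
    (h : continuityApproach.IsEpsRelCompact α D) : escapingMass D ≤ α := by
  refine le_of_forall_gt_imp_ge_of_dense fun γ hγ => ?_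
  obtain ⟨β, hαβ, hβγ⟩ := ENNReal.lt_iff_exists_nnreal_btwn.1 hγ
  obtain ⟨t, ht⟩ := h smoothDist smoothDist_mem_sys
  obtain ⟨M, hM⟩ := ((eventually_all_finset t).2 fun F _ =>
    eventually_forall_tailMass_le F 1 (NNReal.coe_lt_coe.2 (ENNReal.coe_lt_coe.1 hαβ))).exists
  refine (escapingMass_le_of_forall_tailMass_le (M := M) fun H hH => ?_).trans hβγ.le
  obtain ⟨F, hF, hFH⟩ := mem_iUnion₂.1 (ht hH)
  exact hM F hF H (levyClose_of_smoothDist_le (le_of_lt hFH))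

theorem eventually_forall_le_shift_add {ι : Type*} {l : Filter ι} {f g : ι → Cdf} {m : ℝ}
    (hbot : ∀ ε > 0, ∃ A, ∀ᶠ i in l, f i A ≤ m + ε)
    (htop : ∀ ε > 0, ∃ B, ∀ᶠ i in l, 1 ≤ g i B + (m + ε))
    (h : ∀ ε > 0, ∀ x y, x < y → ∀ᶠ i in l, f i x ≤ g i y + (m + ε)) {δ : ℝ} (hδ : 0 < δ) :
    ∀ᶠ i in l, ∀ x, f i x ≤ g i (x + δ) + (m + δ) := by
  obtain ⟨A, hA⟩ := hbot δ hδ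
  obtain ⟨B, hB⟩ := htop δ hδ
  have hmid : ∀ᶠ i in l, ∀ x ∈ Icc A B, f i x ≤ g i (x + δ) + (m + δ) := by
    refine isCompact_Icc.induction_on
      (p := fun s : Set ℝ => ∀ᶠ i in l, ∀ x ∈ s, f i x ≤ g i (x + δ) + (m + δ))
      (by simp) (fun s t hst ht => ht.mono fun i hi x hx => hi x (hst hx))
      (fun s t hs ht => (hs.and ht).mono fun i hi x => Or.rec (hi.1 x) (hi.2 x)) fun x _ => ?_
    refine ⟨Ioo (x - δ / 3) (x + δ / 3), mem_nhdsWithin_of_mem_nhds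
      (Ioo_mem_nhds (by linarith) (by linarith)), ?_⟩
    filter_upwards [h δ hδ (x + δ / 3) (x + δ / 2) (by linarith)] with i hi z hz
    calc f i z ≤ f i (x + δ / 3) := (f i).mono hz.2.le
      _ ≤ g i (x + δ / 2) + (m + δ) := hi
      _ ≤ g i (z + δ) + (m + δ) := by
        linarith [(g i).mono (show x + δ / 2 ≤ z + δ by linarith [hz.1])]
  filter_upwards [hA, hB, hmid] with i hiA hiB himid x
  rcases le_total x A with hxA | hAx
  · linarith [(f i).mono hxA, (g i).nonneg (x + δ)]
  rcases le_total x B with hxB | hBx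
  · exact himid x ⟨hAx, hxB⟩
  · linarith [(f i).le_one x, (g i).mono (hBx.trans (le_add_of_nonneg_right hδ.le))]

theorem le_levyNhds_of_forall_lt {l : Filter Cdf} {m : ℝ≥0} {F : Cdf}
    (hlow : ∀ ε > 0, ∀ x y, x < y → ∀ᶠ K : Cdf in l, F x ≤ K y + (m + ε))
    (hup : ∀ ε > 0, ∀ x y, x < y → ∀ᶠ K : Cdf in l, K x ≤ F y + (m + ε)) :
    l ≤ levyNhds m F := by
  have hbot {ε : ℝ} (hε : 0 < ε) : ∃ x, F x < ε :=
    (F.tendsto_atBot.eventually (gt_mem_nhds hε)).exists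
  have htop {ε : ℝ} (hε : 0 < ε) : ∃ x, 1 - ε < F x :=
    (F.tendsto_atTop.eventually (lt_mem_nhds (sub_lt_self 1 hε))).exists
  refine (hasBasis_levyNhds m F).ge_iff.2 fun δ hδ => ?_
  have hF : ∀ᶠ K in l, ∀ x, F x ≤ K (x + δ) + (m + δ) := by
    refine eventually_forall_le_shift_add (f := fun _ => F) (g := fun K => K) (fun ε hε => ?_)
      (fun ε hε => ?_) hlow hδ
    · obtain ⟨A, hA⟩ := hbot hε
      exact ⟨A, Eventually.of_forall fun _ => by linarith [m.coe_nonneg]⟩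
    · obtain ⟨B, hB⟩ := htop (half_pos hε)
      refine ⟨B + 1, (hlow (ε / 2) (half_pos hε) B (B + 1) (lt_add_one B)).mono fun K hK => ?_⟩
      linarith
  have hK : ∀ᶠ K : Cdf in l, ∀ x, K x ≤ F (x + δ) + (m + δ) := by
    refine eventually_forall_le_shift_add (f := fun K => K) (g := fun _ => F) (fun ε hε => ?_)
      (fun ε hε => ?_) hup hδ
    · obtain ⟨A, hA⟩ := hbot (half_pos hε)
      refine ⟨A - 1, (hup (ε / 2) (half_pos hε) (A - 1) A (sub_one_lt A)).mono fun K hK => ?_⟩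
      linarith
    · obtain ⟨B, hB⟩ := htop hε
      exact ⟨B, Eventually.of_forall fun _ => by linarith [m.coe_nonneg]⟩
  exact (hF.and hK).mono fun K h x => ⟨h.1 x, h.2 x⟩

theorem exists_monotone_tendsto (U : Ultrafilter Cdf) :
    ∃ g : ℝ → ℝ, Monotone g ∧ (∀ x, g x ∈ Icc (0 : ℝ) 1) ∧
      ∀ x, Tendsto (fun K : Cdf => K x) U (𝓝 (g x)) := by
  have (x : ℝ) : ∃ y ∈ Icc (0 : ℝ) 1, Tendsto (fun K : Cdf => K x) U (𝓝 y) :=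
    isCompact_Icc.ultrafilter_le_nhds' (U.map fun K : Cdf => K x)
      (Ultrafilter.mem_map.2 (Eventually.of_forall fun K : Cdf => ⟨K.nonneg x, K.le_one x⟩))
  choose g hg hlim using this
  exact ⟨g, fun x y hxy => le_of_tendsto_of_tendsto' (hlim x) (hlim y) fun K => K.mono hxy, hg,
    hlim⟩

theorem exists_cdf_mem_Icc (f : StieltjesFunction ℝ) {a s : ℝ} (ha : Tendsto f atBot (𝓝 a))
    (hs : Tendsto f atTop (𝓝 s)) (ha0 : 0 ≤ a) (hs1 : s ≤ 1) :
    ∃ F : Cdf, ∀ x, F x ∈ Icc (f x - a) (f x + (1 - s)) := by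
  -- The missing masses `a` at `-∞` and `1 - s` at `∞` are moved to the origin.
  let F : Cdf :=
    { toFun x := if x < 0 then f x - a else f x + (1 - s)
      mono' x y hxy := by
        have := f.mono hxy
        dsimp only
        split_ifs <;> linarith
      right_continuous' x := by
        rcases lt_or_ge x 0 with hx | hx
        · exact ((f.right_continuous x).sub continuousWithinAt_const).congr_of_eventuallyEq
            (eventually_nhdsWithin_of_eventually_nhds ((gt_mem_nhds hx).mono fun y hy => if_pos hy))
            (if_pos hx)
        · exact ((f.right_continuous x).add continuousWithinAt_const).congr
            (fun y (hy : x ≤ y) => if_neg (hx.trans hy).not_gt) (if_neg hx.not_gt)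
      tendsto_atBot' := by
        have h := ha.sub_const a
        rw [sub_self] at h
        exact h.congr' ((eventually_lt_atBot 0).mono fun x hx => (if_pos hx).symm)
      tendsto_atTop' := by
        have h := hs.add_const (1 - s)
        rw [add_sub_cancel] at h
        exact h.congr' ((eventually_ge_atTop 0).mono fun x hx => (if_neg (not_lt.2 hx)).symm) }
  refine ⟨F, fun x => ?_⟩
  change (if x < 0 then f x - a else f x + (1 - s)) ∈ _
  split_ifs <;> constructor <;> linarith

theorem exists_forall_tailMass_le_add (D : Set Cdf) {ε : ℝ} (hε : 0 < ε) :
    ∃ M, ∀ H ∈ D, H.tailMass M ≤ (escapingMass D).toNNReal + ε := by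
  lift ε to ℝ≥0 using hε.le
  have h : escapingMass D < ((escapingMass D).toNNReal + ε : ℝ≥0) := by
    rw [ENNReal.coe_add, ENNReal.coe_toNNReal (escapingMass_ne_top D)]
    exact ENNReal.lt_add_right (escapingMass_ne_top D) (by exact_mod_cast hε.ne')
  obtain ⟨M, hM⟩ := exists_forall_tailMass_lt h
  exact ⟨M, fun H hH => by exact_mod_cast (hM H hH).le⟩

theorem exists_le_levyNhds (U : Ultrafilter Cdf) {D : Set Cdf} (hD : D ∈ U) :
    ∃ F, (U : Filter Cdf) ≤ levyNhds (escapingMass D).toNNReal F := by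
  set m := (escapingMass D).toNNReal
  obtain ⟨g, hg, hg01, hlim⟩ := exists_monotone_tendsto U
  let G := hg.stieltjesFunction
  have hgG (x : ℝ) : g x ≤ G x := hg.le_rightLim le_rfl
  have hGg {x y : ℝ} (hxy : x < y) : G x ≤ g y := hg.rightLim_le hxy
  have hG0 (x : ℝ) : 0 ≤ G x := (hg01 x).1.trans (hgG x)
  have hG1 (x : ℝ) : G x ≤ 1 := (hGg (lt_add_one x)).trans (hg01 _).2
  have bddBelow_G : BddBelow (range G) := ⟨0, forall_mem_range.2 hG0⟩
  have bddAbove_G : BddAbove (range G) := ⟨1, forall_mem_range.2 hG1⟩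
  obtain ⟨F, hF⟩ := exists_cdf_mem_Icc G (tendsto_atBot_ciInf G.mono bddBelow_G)
    (tendsto_atTop_ciSup G.mono bddAbove_G) (le_ciInf hG0) (ciSup_le hG1)
  have hinf : ⨅ x, G x ≤ m := le_of_forall_pos_le_add fun ε hε => by
    obtain ⟨M, hM⟩ := exists_forall_tailMass_le_add D hε
    calc ⨅ x, G x ≤ G (-M - 1) := ciInf_le bddBelow_G _
      _ ≤ g (-M) := hGg (sub_one_lt _)
      _ ≤ m + ε := le_of_tendsto (hlim _)
        (mem_of_superset hD fun H hH => (tailMass_le_iff.1 (hM H hH)).1)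
  have hsup : 1 - m ≤ ⨆ x, G x := le_of_forall_pos_le_add fun ε hε => by
    obtain ⟨M, hM⟩ := exists_forall_tailMass_le_add D hε
    have hgM : 1 - (m + ε) ≤ g M := ge_of_tendsto (hlim M)
      (mem_of_superset hD fun H hH => sub_le_comm.1 (tailMass_le_iff.1 (hM H hH)).2)
    linarith [hgG M, le_ciSup bddAbove_G M]
  refine ⟨F, le_levyNhds_of_forall_lt (fun ε hε x y hxy => ?_) fun ε hε x y hxy => ?_⟩
  · filter_upwards [(hlim y).eventually (lt_mem_nhds (sub_lt_self (g y) hε))] with K hK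
    linarith [(hF x).2, hGg hxy]
  · filter_upwards [(hlim x).eventually (gt_mem_nhds (lt_add_of_pos_right (g x) hε))] with K hK
    linarith [(hF x).1, hgG x, F.mono hxy.le]

theorem exists_subseq_tendsto_levyNhds {D : Set Cdf} {a : ℕ → Cdf} (ha : ∀ n, a n ∈ D) :
    ∃ k : ℕ → ℕ, StrictMono k ∧
      ∃ F, Tendsto (a ∘ k) atTop (levyNhds (escapingMass D).toNNReal F) := by
  obtain ⟨F, hF⟩ := exists_le_levyNhds ((hyperfilter ℕ).map a)
    (Ultrafilter.mem_map.2 (Eventually.of_forall ha))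
  have hle : (((hyperfilter ℕ).map a : Ultrafilter Cdf) : Filter Cdf) ≤
      levyNhds (escapingMass D).toNNReal F ⊓ map a atTop :=
    le_inf hF (map_mono Nat.hyperfilter_le_atTop)
  obtain ⟨k, hk, hlim⟩ := subseq_tendsto_of_neBot (neBot_of_le hle)
  exact ⟨k, hk, F, hlim⟩

theorem isEpsRelSeqCompact_of_escapingMass_lt {D : Set Cdf} {α : ℝ≥0∞} (h : escapingMass D < α) :
    continuityApproach.IsEpsRelSeqCompact α D := fun a ha => by
  rw [← ENNReal.coe_toNNReal (escapingMass_ne_top D)] at h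
  obtain ⟨k, hk, F, hF⟩ := exists_subseq_tendsto_levyNhds ha
  exact ⟨k, hk, F, fun φ hφ => hF.eventually (eventually_lt_of_mem_sys hφ h)⟩

theorem isEpsRelCompact_of_escapingMass_lt {D : Set Cdf} {α : ℝ≥0∞} (h : escapingMass D < α) :
    continuityApproach.IsEpsRelCompact α D := by
  rw [← ENNReal.coe_toNNReal (escapingMass_ne_top D)] at h
  refine ApproachSystem.isEpsRelCompact_of_forall_ultrafilter fun U hD => ?_
  obtain ⟨F, hF⟩ := exists_le_levyNhds U hD
  exact ⟨F, fun φ hφ => hF (eventually_lt_of_mem_sys hφ h)⟩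

theorem chiRsc_eq_escapingMass (D : Set Cdf) : continuityApproach.chiRsc D = escapingMass D :=
  sInf_setOf_pos_ne_top_eq (fun _ _ => isEpsRelSeqCompact_of_escapingMass_lt) fun α hα h => by
    lift α to ℝ≥0 using hα
    exact escapingMass_le_of_isEpsRelSeqCompact h

theorem chiRc_eq_escapingMass (D : Set Cdf) : continuityApproach.chiRc D = escapingMass D :=
  sInf_setOf_pos_ne_top_eq (fun _ _ => isEpsRelCompact_of_escapingMass_lt) fun α hα h => by
    lift α to ℝ≥0 using hα
    exact escapingMass_le_of_isEpsRelCompact h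

theorem exists_forall_le_integral_le {x y : ℝ} (hxy : x < y) :
    ∃ h : ℝ →ᵇ ℝ, ∀ K : Cdf, K x ≤ ∫ t, h t ∂K.measure ∧ ∫ t, h t ∂K.measure ≤ K y := by
  have real_Iic (K : Cdf) (z : ℝ) : K.measure.real (Iic z) = K z := by
    rw [measureReal_def, measure, StieltjesFunction.measure_Iic _ K.tendsto_atBot, sub_zero,
      ENNReal.toReal_ofReal (K.nonneg z)]
  obtain ⟨h, h0, h1, h01⟩ := exists_bounded_zero_one_of_closed (isClosed_Ici (a := y))
    (isClosed_Iic (a := x)) (disjoint_left.2 fun t hyt htx => (hxy.trans_le hyt).not_ge htx)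
  have integrable_indicator (K : Cdf) (z : ℝ) :
      Integrable ((Iic z).indicator fun _ => (1 : ℝ)) K.measure :=
    (integrable_const 1).indicator measurableSet_Iic
  refine ⟨h, fun K => ⟨?_, ?_⟩⟩
  · rw [← real_Iic, ← integral_indicator_one measurableSet_Iic]
    refine integral_mono (integrable_indicator K x) (h.integrable K.measure) fun t => ?_
    exact indicator_le' (fun t ht => (h1 ht).ge) (fun t _ => (h01 t).1) t
  · rw [← real_Iic, ← integral_indicator_one measurableSet_Iic]
    refine integral_mono (h.integrable K.measure) (integrable_indicator K y) fun t => ?_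
    exact le_indicator (fun t _ => (h01 t).2) (fun t ht => (h0 (mem_Ici.2 (not_le.1 ht).le)).le) t

theorem nhds_le_levyNhds_zero (F : Cdf) : 𝓝 F ≤ levyNhds 0 F := by
  have continuous_integral (h : ℝ →ᵇ ℝ) : Continuous fun K : Cdf => ∫ t, h t ∂K.measure :=
    continuous_iInf_dom (i := h) continuous_induced_dom
  refine le_levyNhds_of_forall_lt (fun ε hε x y hxy => ?_) fun ε hε x y hxy => ?_ <;>
    obtain ⟨h, hh⟩ := exists_forall_le_integral_le hxy
  · filter_upwards [(continuous_integral h).continuousAt.eventually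
      (lt_mem_nhds (sub_lt_self _ hε))] with K hK
    simp only [NNReal.coe_zero]
    linarith [(hh F).1, (hh K).2]
  · filter_upwards [(continuous_integral h).continuousAt.eventually
      (gt_mem_nhds (lt_add_of_pos_right _ hε))] with K hK
    simp only [NNReal.coe_zero]
    linarith [(hh F).2, (hh K).1]

theorem tendsto_apply_levyNhds_zero {F : Cdf} {x : ℝ} (hx : ContinuousAt F x) :
    Tendsto (fun K : Cdf => K x) (levyNhds 0 F) (𝓝 (F x)) := by
  refine Metric.tendsto_nhds.2 fun ε hε => ?_
  obtain ⟨η, hη, hF⟩ := Metric.continuousAt_iff.1 hx (ε / 2) (half_pos hε)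
  obtain ⟨δ, hδ, hδlt⟩ := exists_between (lt_min hη (half_pos hε))
  obtain ⟨hδη, hδε⟩ := lt_min_iff.1 hδlt
  filter_upwards [eventually_levyClose hδ 0 F] with K hK
  have h_right := hF (x := x + δ) (by simpa [Real.dist_eq, abs_of_pos hδ] using hδη)
  have h_left := hF (x := x - δ) (by simpa [Real.dist_eq, abs_of_pos hδ] using hδη)
  have hK_left := (hK (x - δ)).1
  have hK_right := (hK x).2
  rw [sub_add_cancel] at hK_left
  rw [NNReal.coe_zero] at hK_left hK_right
  rw [Real.dist_eq, abs_lt] at h_left h_right ⊢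
  constructor <;> linarith [h_left.1, h_right.2]

theorem dense_setOf_continuousAt (F : Cdf) : Dense {x | ContinuousAt F x} := by
  simpa only [compl_ofPred, not_not] using F.mono.countable_not_continuousAt.dense_compl ℝ

/-- The Lebesgue–Stieltjes measure of a cdf as a point of the space of probability measures. -/
noncomputable def toProbabilityMeasure (F : Cdf) : ProbabilityMeasure ℝ :=
  ⟨F.measure, inferInstance⟩

theorem tendsto_nhds_iff_toProbabilityMeasure {ι : Type*} {l : Filter ι} {a : ι → Cdf} {F : Cdf} :
    Tendsto a l (𝓝 F) ↔
      Tendsto (fun i => (a i).toProbabilityMeasure) l (𝓝 F.toProbabilityMeasure) := by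
  rw [ProbabilityMeasure.tendsto_iff_forall_integral_tendsto, nhds_iInf, tendsto_iInf]
  refine forall_congr' fun h => ?_
  rw [nhds_induced, tendsto_comap_iff]
  rfl

theorem tendsto_nhds_of_tendsto_apply {ι : Type*} {l : Filter ι} [l.IsCountablyGenerated]
    {a : ι → Cdf} {F : Cdf}
    (h : ∀ x, ContinuousAt F x → Tendsto (fun i => a i x) l (𝓝 (F x))) : Tendsto a l (𝓝 F) := by
  rw [tendsto_nhds_iff_toProbabilityMeasure]
  refine IsPiSystem.tendsto_probabilityMeasure_of_tendsto_of_mem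
    (S := {s | ∃ x y, ContinuousAt F x ∧ ContinuousAt F y ∧ s = Ioc x y}) ?_ ?_ ?_ ?_
  · rintro _ ⟨x, y, hx, hy, rfl⟩ _ ⟨x', y', hx', hy', rfl⟩ _
    refine ⟨max x x', min y y', ?_, ?_, Ioc_inter_Ioc⟩
    · rcases max_choice x x' with e | e <;> rwa [e]
    · rcases min_choice y y' with e | e <;> rwa [e]
  · rintro _ ⟨x, y, -, -, rfl⟩
    exact measurableSet_Ioc
  · intro u hu x hx
    obtain ⟨p, q, ⟨hpx, hxq⟩, hpq⟩ := mem_nhds_iff_exists_Ioo_subset.1 (hu.mem_nhds hx)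
    obtain ⟨p', hp', hpp', hp'x⟩ := F.dense_setOf_continuousAt.exists_between hpx
    obtain ⟨q', hq', hxq', hq'q⟩ := F.dense_setOf_continuousAt.exists_between hxq
    exact ⟨_, ⟨p', q', hp', hq', rfl⟩, Ioc_mem_nhds hp'x hxq',
      fun z hz => hpq ⟨hpp'.trans hz.1, hz.2.trans_lt hq'q⟩⟩
  · rintro _ ⟨x, y, hx, hy, rfl⟩
    rw [← ENNReal.tendsto_coe]
    simp only [ProbabilityMeasure.ennreal_coeFn_eq_coeFn_toMeasure]
    change Tendsto (fun i => (a i).measure (Ioc x y)) l (𝓝 (F.measure (Ioc x y)))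
    simp only [measure, StieltjesFunction.measure_Ioc]
    exact ENNReal.tendsto_ofReal ((h y hy).sub (h x hx))

theorem nhds_eq_levyNhds_zero (F : Cdf) : 𝓝 F = levyNhds 0 F :=
  le_antisymm (nhds_le_levyNhds_zero F)
    (tendsto_nhds_of_tendsto_apply (l := levyNhds 0 F) (a := id) fun _ =>
      tendsto_apply_levyNhds_zero)

theorem isWeaklyRelSeqCompact_iff_escapingMass_eq_zero (D : Set Cdf) :
    IsWeaklyRelSeqCompact D ↔ escapingMass D = 0 := by
  constructor
  · refine fun h => le_antisymm (ENNReal.le_of_forall_pos_le_add fun ε hε _ => ?_) zero_le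
    rw [zero_add]
    refine escapingMass_le_of_forall_seq (δ := ε) fun a ha => ?_
    obtain ⟨k, hk, F, hF⟩ := h a ha
    rw [nhds_eq_levyNhds_zero] at hF
    exact ⟨k, hk, F, by simpa using hF.eventually (eventually_levyClose hε 0 F)⟩
  · intro h a ha
    simpa only [nhds_eq_levyNhds_zero, h, ENNReal.toNNReal_zero] using
      exists_subseq_tendsto_levyNhds ha

end Cdf

theorem theorem3p10 (D : Set Cdf) :
    continuityApproach.chiRsc D = continuityApproach.chiRc D ∧
      (Cdf.IsWeaklyRelSeqCompact D ↔ continuityApproach.chiRsc D = 0) := by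
  rw [Cdf.chiRsc_eq_escapingMass, Cdf.chiRc_eq_escapingMass]
  exact ⟨rfl, Cdf.isWeaklyRelSeqCompact_iff_escapingMass_eq_zero D⟩
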